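/- Let $\Sigma=\mathbb R^3$. An edge is an oriented analytic curve $e:[0,1]\to\mathbb R^3$ (analytic up to the endpoints, $\dot e\neq 0$, injective except that possibly $e(0)=e(1)$), up to orientation-preserving reparametrization; a graph $\gamma$ is a finite set $E(\gamma)$ of edges, two distinct ones of which meet at most in common endpoints. Let $\overline{\mathcal A}_{U(1)}$ be the space of generalized $U(1)$ connections, i.e. of maps $A$ assigning to each edge $e$ a holonomy $h_e[A]\in U(1)$ such that $h_e=h_{e_1}h_{e_2}$ if $e$ is the composition of $e_1$ and $e_2$, and $h_{e^{-1}}=h_e^{-1}$; its $\sigma$-algebra is generated by the holonomies. For a graph $\gamma$ let $\pi_\gamma(A)=(h_e[A])_{e\in E(\gamma)}\in U(1)^{E(\gamma)}$. Let $\mu$ be a positive, normalized measure on $\overline{\mathcal A}_{U(1)}$ such that: (a) (factorizing) for every graph $\gamma$, $(\pi_\gamma)_*\mu=f_\gamma\,\mu_H^{E(\gamma)}$ with $\mu_H$ the normalized Haar measure of $U(1)$ and a density $f_\gamma\ge 0$ of the form $f_\gamma(g)=\prod_{e\in E(\gamma)}f_e(g_e)$, where $f_e$ depends only on the edge $e$;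 (b) (Euclidean invariant) $\int c\big((h_e[A])_{e\in E(\gamma)}\big)\,d\mu(A)=\int c\big((h_{T(e)}[A])_{e\in E(\gamma)}\big)\,d\mu(A)$ for every graph $\gamma$, every continuous $c:U(1)^{E(\gamma)}\to\mathbb C$ and every Euclidean transformation $T$ of $\mathbb R^3$ (it suffices to assume this for orientation-preserving $T$); (c) $\mu$ possesses an admissible surface: there is an oriented, simply connected, analytically embedded surface $S\subset\mathbb R^3$ without boundary such that the antilinear form $$\Delta_S(c)=\langle iX_S[c],1\rangle_{L^2(\mu)},\qquad X_S[c]=\frac{\kappa}{2}\sum_{e\in E(\gamma)}I(S,e)\,\frac{\partial c}{\partial\varphi_e},$$ on smooth cylindrical functions $c=c\big((h_e)_{e\in E(\gamma)}\big)$, $h_e=e^{i\varphi_e}$, is given by an element of $L^2(\overline{\mathcal A}_{U(1)},\mu)$. Here $\kappa>0$ is the coupling constant, and $I(S,e)=P_+-P_-+\frac12(I_+-I_-)$ is the signed intersection number: $P_\pm$ is the number of intersections of positive/negative relative orientation at interior points of $e$, $I_\pm$ the number of those at the start or end of $e$, and tangential intersections are not counted. (If some edges have infinitely many non-tangential intersections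 with $S$, only graphs without such edges are considered.) Then $\mu$ is the Ashtekar–Lewandowski measure $\mu_{AL}$, i.e. the measure given by $f_\gamma=1$ for all graphs $\gamma$. -/

import Mathlib

open MeasureTheory
open scoped ContDiff Gradient ComplexConjugate

noncomputable section

namespace U1Connections

/-- The spatial manifold `Σ = ℝ³`, with its Euclidean structure. -/
abbrev E3 : Type := EuclideanSpace ℝ (Fin 3)

/-- `U(1)` carries its Borel σ-algebra. -/
instance instMeasurableSpaceCircle : MeasurableSpace Circle := borel Circle

instance instBorelSpaceCircle : BorelSpace Circle := ⟨rfl⟩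

/-- The normalized Haar measure on `U(1)`. -/
def haarU1 : Measure Circle := Measure.haarMeasure ⊤

/-! ### Edges and graphs -/

/-- A parametrized oriented analytic edge in `ℝ³`: a map on `[0,1]` that is analytic up to and
including the endpoints, regular, and injective, except that the two endpoints may coincide (loops).
Only the values on `[0,1]` matter; an edge is a class of these under `Reparam`. -/
structure Edge where
  toFun : ℝ → E3
  analytic : AnalyticOnNhd ℝ toFun (Set.Icc 0 1)
  deriv_ne_zero : ∀ t ∈ Set.Icc (0 : ℝ) 1, deriv toFun t ≠ 0
  injective : ∀ s ∈ Set.Icc (0 : ℝ) 1, ∀ t ∈ Set.Icc (0 : ℝ) 1,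
    s < t → toFun s = toFun t → s = 0 ∧ t = 1

namespace Edge

/-- The set of points of an edge. -/
def image (e : Edge) : Set E3 := e.toFun '' Set.Icc 0 1

/-- The endpoints of an edge. -/
def endpoints (e : Edge) : Set E3 := {e.toFun 0, e.toFun 1}

/-- `e'` is obtained from `e` by an orientation preserving reparametrization of `[0,1]`. -/
def Reparam (e e' : Edge) : Prop :=
  ∃ φ : ℝ → ℝ, ContinuousOn φ (Set.Icc 0 1) ∧ StrictMonoOn φ (Set.Icc 0 1) ∧ φ 0 = 0 ∧ φ 1 = 1 ∧
    ∀ t ∈ Set.Icc (0 : ℝ) 1, e'.toFun t = e.toFun (φ t)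

/-- `e` is the composition of `e₁` (traversed first) and `e₂`: subdividing `e` at an interior
parameter `r` gives `e₁` and `e₂`. -/
def IsComposition (e e₁ e₂ : Edge) : Prop :=
  ∃ r ∈ Set.Ioo (0 : ℝ) 1, (∀ t ∈ Set.Icc (0 : ℝ) 1, e₁.toFun t = e.toFun (r * t)) ∧
    ∀ t ∈ Set.Icc (0 : ℝ) 1, e₂.toFun t = e.toFun (r + (1 - r) * t)

/-- `e'` is `e` with the opposite orientation. -/
def IsReverse (e e' : Edge) : Prop :=
  ∀ t ∈ Set.Icc (0 : ℝ) 1, e'.toFun t = e.toFun (1 - t)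

theorem hasDerivAt (e : Edge) {t : ℝ} (ht : t ∈ Set.Icc (0 : ℝ) 1) :
    HasDerivAt e.toFun (deriv e.toFun t) t :=
  (e.analytic t ht).differentiableAt.hasDerivAt

/-- The image `T(e)` of an edge under an isometry `T` of `ℝ³`. -/
def map (T : E3 ≃ᵃⁱ[ℝ] E3) (e : Edge) : Edge where
  toFun t := T (e.toFun t)
  analytic t ht := by
    have h : (fun t => T (e.toFun t)) =
        fun t => T.linearIsometryEquiv.toContinuousLinearEquiv.toContinuousLinearMap (e.toFun t)
          + T 0 := by
      funext s
      simpa using T.map_vadd 0 (e.toFun s)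
    rw [h]
    exact ((ContinuousLinearMap.analyticAt _ _).comp (e.analytic t ht)).add analyticAt_const
  deriv_ne_zero t ht := by
    have h : (fun t => T (e.toFun t)) =
        fun t => T.linearIsometryEquiv.toContinuousLinearEquiv.toContinuousLinearMap (e.toFun t)
          + T 0 := by
      funext s
      simpa using T.map_vadd 0 (e.toFun s)
    rw [h]
    have hd := ((T.linearIsometryEquiv.toContinuousLinearEquiv.toContinuousLinearMap).hasFDerivAt
      |>.comp_hasDerivAt t (e.hasDerivAt ht)).add_const (T 0)
    have hd' := hd.deriv
    simp only [Function.comp_def] at hd'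
    rw [hd']
    simpa using e.deriv_ne_zero t ht
  injective s hs t ht hst h := e.injective s hs t ht hst (T.injective h)

end Edge

/-- A graph: a finite set of edges such that two distinct ones intersect at most in points that are
endpoints of both. -/
structure Graph where
  edges : Finset Edge
  inter : ∀ e ∈ edges, ∀ e' ∈ edges, e ≠ e' →
    e.image ∩ e'.image ⊆ e.endpoints ∩ e'.endpoints

/-! ### Generalized connections -/

/-- A generalized `U(1)` connection: an assignment of holonomies to edges that is independent of the
parametrization and compatible with composition and inversion of edges. These are the elements of
the projective limit over graphs `γ` of the spaces `U(1)^{E(γ)}`. -/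
structure IsGeneralizedConnection (A : Edge → Circle) : Prop where
  reparam : ∀ e e', e.Reparam e' → A e' = A e
  comp : ∀ e e₁ e₂, e.IsComposition e₁ e₂ → A e = A e₁ * A e₂
  reverse : ∀ e e', e.IsReverse e' → A e' = (A e)⁻¹

/-- The space of generalized `U(1)` connections on `ℝ³`. Its σ-algebra (the instance inherited from
the product) is the one generated by all the holonomies, i.e. the Baire σ-algebra of the compact
Hausdorff projective limit. -/
abbrev GenConn : Type := {A : Edge → Circle // IsGeneralizedConnection A}

/-- The projection `π_γ` to `U(1)^{E(γ)}`. -/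
def proj (γ : Graph) (A : GenConn) : γ.edges → Circle := fun e => A.1 e

/-! ### Measures given by densities -/

/-- The measure `μ` is given by the family of densities `f`: for every graph `γ`, its projection to
`U(1)^{E(γ)}` has the nonnegative density `f γ` with respect to the product of Haar measures. -/
structure HasDensities (μ : Measure GenConn) (f : (γ : Graph) → (γ.edges → Circle) → ℝ) :
    Prop where
  measurable : ∀ γ, Measurable (f γ)
  nonneg : ∀ γ g, 0 ≤ f γ g
  map_eq : ∀ γ, μ.map (proj γ) =
    (Measure.pi fun _ : γ.edges => haarU1).withDensity fun g => ENNReal.ofReal (f γ g)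

/-- `μ` is factorizing: it is given by a family of densities, and each density is the product
of functions depending on single edges only. (Applied to graphs with a single edge `e`, this says
that `φ e` is the density belonging to `e`.) -/
def IsFactorizing (μ : Measure GenConn) : Prop :=
  ∃ (f : (γ : Graph) → (γ.edges → Circle) → ℝ) (φ : Edge → Circle → ℝ),
    HasDensities μ f ∧ ∀ γ g, f γ g = ∏ e : γ.edges, φ e (g e)

/-- `μ` is the Ashtekar-Lewandowski measure: all the densities are equal to `1`. -/
def IsAshtekarLewandowski (μ : Measure GenConn) : Prop :=
  HasDensities μ fun _ _ => 1

/-- `μ` is Euclidean invariant: `∫ F dμ = ∫ T(F) dμ` for every cylindrical function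
`F[A] = c(h_{e_1}[A], …, h_{e_n}[A])`, where `c` is continuous and `e_1, …, e_n` are the edges of a
graph, and every orientation preserving Euclidean motion `T`, where
`T(F)[A] = c(h_{T(e_1)}[A], …, h_{T(e_n)}[A])`. -/
def IsEuclideanInvariant (μ : Measure GenConn) : Prop :=
  ∀ T : E3 ≃ᵃⁱ[ℝ] E3, LinearMap.det (T.linearIsometryEquiv.toLinearEquiv : E3 →ₗ[ℝ] E3) = 1 →
    ∀ (γ : Graph) (c : (γ.edges → Circle) → ℂ), Continuous c →
      ∫ A : GenConn, c (proj γ A) ∂μ = ∫ A : GenConn, c (fun e => A.1 (e.1.map T)) ∂μ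

/-! ### Surfaces and admissibility -/

/-- An oriented, simply connected, analytically embedded surface without boundary in `ℝ³`. The
orientation is given by the unit normal field `normal` (relevant on `carrier` only); locally the
surface is the zero set of an analytic function with nonvanishing gradient, and the normal is the
normalized gradient. -/
structure Surface where
  carrier : Set E3
  normal : E3 → E3
  simplyConnected : SimplyConnectedSpace carrier
  embedded : ∀ p ∈ carrier, ∃ (U : Set E3) (g : E3 → ℝ), IsOpen U ∧ p ∈ U ∧ AnalyticOnNhd ℝ g U ∧
    (∀ x ∈ U, ∇ g x ≠ 0) ∧ carrier ∩ U = {x ∈ U | g x = 0} ∧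
    ∀ x ∈ carrier ∩ U, normal x = ‖∇ g x‖⁻¹ • ∇ g x

namespace Surface

/-- The relative orientation `±1` of `S` and `e` at the parameter `t`, where `e` meets `S`; it is
`0` if `e` is tangential to `S` there. -/
def orientationSign (S : Surface) (e : Edge) (t : ℝ) : ℝ :=
  Real.sign (inner ℝ (S.normal (e.toFun t)) (deriv e.toFun t))

/-- The (parameters of the) non-tangential intersections of `e` with `S`. -/
def crossings (S : Surface) (e : Edge) : Set ℝ :=
  {t ∈ Set.Icc (0 : ℝ) 1 | e.toFun t ∈ S.carrier ∧ S.orientationSign e t ≠ 0}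

open Classical in
/-- The signed intersection number `I(S,e) = P₊ - P₋ + (I₊ - I₋)/2`: intersections at interior
points of `e` have weight `1`, those at its start and end have weight `1/2`. -/
def intersectionNumber (S : Surface) (e : Edge) : ℝ :=
  ∑ᶠ t ∈ S.crossings e, (if t = 0 ∨ t = 1 then 1 / 2 else 1) * S.orientationSign e t

end Surface

/-- Smoothness of a function on `U(1)^{E(γ)}`, expressed in the angles `φ_e`. -/
def SmoothOnTorus {ι : Type*} [Fintype ι] (c : (ι → Circle) → ℂ) : Prop :=
  ContDiff ℝ ∞ fun θ : ι → ℝ => c fun i => Circle.exp (θ i)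

open Classical in
/-- The invariant vector field `∂/∂φ_i` of the `i`-th factor, acting on functions on a torus. -/
def angleDeriv {ι : Type*} (i : ι) (c : (ι → Circle) → ℂ) (g : ι → Circle) : ℂ :=
  deriv (fun s : ℝ => c (Function.update g i (Circle.exp s * g i))) 0

/-- The flux vector field `X_S = (κ/2) ∑_e I(S,e) ∂/∂φ_e` acting on functions of the holonomies
along the edges of `γ`. -/
def fluxDeriv (κ : ℝ) (S : Surface) (γ : Graph) (c : (γ.edges → Circle) → ℂ)
    (g : γ.edges → Circle) : ℂ :=
  (κ / 2 : ℝ) * ∑ e : γ.edges, (S.intersectionNumber e : ℂ) * angleDeriv e c g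

/-- `S` is admissible with respect to `μ`: the antilinear form `Δ_S(c) = ⟨i X_S[c], 1⟩` on smooth
cylindrical functions is given by a function `F` in `L²(μ)`, i.e. `Δ_S(c) = ⟨c, F⟩`, where inner
products are antilinear in the first entry. It is required only for those graphs for which
`X_S` makes sense, i.e. whose edges have finitely many non-tangential intersections with `S`. -/
def IsAdmissible (κ : ℝ) (μ : Measure GenConn) (S : Surface) : Prop :=
  ∃ F : GenConn → ℂ, MemLp F 2 μ ∧
    ∀ (γ : Graph), (∀ e ∈ γ.edges, (S.crossings e).Finite) →
      ∀ c : (γ.edges → Circle) → ℂ, SmoothOnTorus c →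
        ∫ A : GenConn, conj (Complex.I * fluxDeriv κ S γ c (proj γ A)) ∂μ =
          ∫ A : GenConn, conj (c (proj γ A)) * F A ∂μ

end U1Connections

end

noncomputable section

namespace U1Connections

open ProbabilityTheory

/-! ### Measures on the circle and on tori -/

/-! Fix an edge and `m ≠ 0`, and let `M` be the mean of `h ^ m` along a short initial piece. Rotate
the piece to be transversal to the admissible surface `S` at a point `p`, then shift it by
infinitely many small vectors tangent to `S` at `p`. The copies are disjoint and each crosses `S`
once, positively (`exists_disjoint_crossing_copies`).

By invariance every copy has the same mean `M`, and by factorization the centred modes `h_k ^ m - M`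
are bounded and pairwise orthogonal in `L²(μ)`. The flux derivative kills the constant `M` but not
`h_k ^ m`, so `Δ_S` takes the same value, a nonzero multiple of `conj M`, on all of them. By a
Bessel-type estimate an `L²` function cannot have one common nonzero inner product with infinitely
many bounded orthogonal vectors (`eq_zero_of_inner_eq_of_orthogonal`), hence `M = 0`
(`integral_zpow_eq_zero_of_copies`).

The whole edge is this piece followed by an independent remainder, so its coefficient vanishes too.
Thus every holonomy is Haar distributed, and independence within each graph gives the product Haar
measure. -/

instance isProbabilityMeasure_haarU1 : IsProbabilityMeasure haarU1 :=
  ⟨Measure.haarMeasure_self (K₀ := (⊤ : TopologicalSpace.PositiveCompacts Circle))⟩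

instance isHaarMeasure_haarU1 : haarU1.IsHaarMeasure := by
  unfold haarU1; infer_instance

theorem continuous_coe_zpow (m : ℤ) : Continuous fun z : Circle => ((z ^ m : Circle) : ℂ) :=
  continuous_subtype_val.comp (continuous_zpow m)

/-- Translation by `exp (iπ/m)` preserves Haar measure and changes the sign of `z ^ m`. -/
theorem integral_zpow_haarU1 {m : ℤ} (hm : m ≠ 0) :
    ∫ z : Circle, ((z ^ m : Circle) : ℂ) ∂haarU1 = 0 := by
  have h := integral_mul_left_eq_self (μ := haarU1) (fun z : Circle => ((z ^ m : Circle) : ℂ))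
    (Circle.exp (Real.pi / m))
  have hw : ((Circle.exp (Real.pi / m) ^ m : Circle) : ℂ) = -1 := by
    rw [← Circle.exp_zsmul, Circle.coe_exp, zsmul_eq_mul,
      mul_div_cancel₀ _ (Int.cast_ne_zero.mpr hm), Complex.exp_pi_mul_I]
  simp only [mul_zpow, Circle.coe_mul, hw, integral_const_mul] at h
  linear_combination (-1 / 2 : ℂ) * h

instance fact_two_pi_pos : Fact (0 < 2 * Real.pi) := ⟨Real.two_pi_pos⟩

/-- Integration against a finite measure, as a continuous functional of functions on `ℝ/2πℤ`. -/
def integralFunctional (ν : Measure Circle) [IsFiniteMeasure ν] :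
    C(AddCircle (2 * Real.pi), ℂ) →L[ℂ] ℂ :=
  LinearMap.mkContinuous
    { toFun := fun g : C(AddCircle (2 * Real.pi), ℂ) => ∫ z, g (AddCircle.homeomorphCircle'.symm z) ∂ν
      map_add' := fun f g : C(AddCircle (2 * Real.pi), ℂ) => integral_add
        ((f.continuous.comp AddCircle.homeomorphCircle'.symm.continuous).integrable_of_hasCompactSupport
          (HasCompactSupport.of_compactSpace _))
        ((g.continuous.comp AddCircle.homeomorphCircle'.symm.continuous).integrable_of_hasCompactSupport
          (HasCompactSupport.of_compactSpace _))
      map_smul' := fun c g => integral_const_mul c _ }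
    (ν.real Set.univ) fun g : C(AddCircle (2 * Real.pi), ℂ) => by
      refine le_of_le_of_eq ?_ (mul_comm _ _)
      exact norm_integral_le_of_norm_le_const (Filter.Eventually.of_forall fun z =>
        g.norm_coe_le_norm _)

/-- A probability measure on the circle whose nontrivial Fourier coefficients vanish is the Haar
measure. -/
theorem eq_haarU1_of_integral_zpow_eq_zero (ν : Measure Circle) [IsProbabilityMeasure ν]
    (h : ∀ m : ℤ, m ≠ 0 → ∫ z : Circle, ((z ^ m : Circle) : ℂ) ∂ν = 0) : ν = haarU1 := by
  have hfourier : ∀ (m : ℤ) (z : Circle),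
      fourier (T := 2 * Real.pi) m (AddCircle.homeomorphCircle'.symm z) = ((z ^ m : Circle) : ℂ) := by
    intro m z
    obtain ⟨x, rfl⟩ := AddCircle.homeomorphCircle'.surjective z
    induction x using QuotientAddGroup.induction_on with
    | H x =>
      rw [Homeomorph.symm_apply_apply]
      erw [fourier_coe_apply]
      rw [AddCircle.homeomorphCircle'_apply_mk, ← Circle.exp_zsmul, Circle.coe_exp, zsmul_eq_mul]
      congr 1
      push_cast
      have : (Real.pi : ℂ) ≠ 0 := by exact_mod_cast Real.pi_ne_zero
      field_simp
  -- Two continuous functionals agreeing on the Fourier monomials agree everywhere, since these span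
  -- a dense subspace.
  have hL : integralFunctional ν = integralFunctional haarU1 := by
    refine ContinuousLinearMap.ext_on (s := Set.range (@fourier (2 * Real.pi))) ?_ ?_
    · exact Submodule.dense_iff_topologicalClosure_eq_top.mpr span_fourier_closure_eq_top
    · rintro _ ⟨m, rfl⟩
      change ∫ z, fourier m (AddCircle.homeomorphCircle'.symm z) ∂ν =
        ∫ z, fourier m (AddCircle.homeomorphCircle'.symm z) ∂haarU1
      simp only [hfourier]
      rcases eq_or_ne m 0 with rfl | hm
      · simp
      · rw [h m hm, integral_zpow_haarU1 hm]
  refine ext_of_forall_integral_eq_of_IsFiniteMeasure fun f => ?_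
  have := congrArg (fun L : C(AddCircle (2 * Real.pi), ℂ) →L[ℂ] ℂ =>
    L ⟨fun x => (f (AddCircle.homeomorphCircle' x) : ℂ), by fun_prop⟩) hL
  change ∫ z, (f (AddCircle.homeomorphCircle' (AddCircle.homeomorphCircle'.symm z)) : ℂ) ∂ν =
    ∫ z, (f (AddCircle.homeomorphCircle' (AddCircle.homeomorphCircle'.symm z)) : ℂ) ∂haarU1 at this
  simp only [Homeomorph.apply_symm_apply] at this
  rw [integral_complex_ofReal, integral_complex_ofReal] at this
  exact_mod_cast this

/-- It suffices to compare boxes; there the integrand is a product of functions of independent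
coordinates. -/
theorem withDensity_prod_eq_pi {ι X : Type*} [Fintype ι] [MeasurableSpace X] (μ : Measure X)
    [IsProbabilityMeasure μ] {φ : ι → X → ENNReal} (hφ : ∀ i, Measurable (φ i))
    [∀ i, SigmaFinite (μ.withDensity (φ i))] :
    (Measure.pi fun _ : ι => μ).withDensity (fun g => ∏ i, φ i (g i)) =
      Measure.pi fun i => μ.withDensity (φ i) := by
  symm
  refine Measure.pi_eq fun s hs => ?_
  rw [withDensity_apply _ (MeasurableSet.univ_pi hs),
    ← lintegral_indicator (MeasurableSet.univ_pi hs)]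
  have h : ∀ g : ι → X, (Set.univ.pi s).indicator (fun g => ∏ i, φ i (g i)) g =
      ∏ i, (s i).indicator (φ i) (g i) := by
    intro g
    by_cases hg : g ∈ Set.univ.pi s
    · rw [Set.indicator_of_mem hg]
      exact Finset.prod_congr rfl fun i _ => by rw [Set.indicator_of_mem (hg i trivial)]
    · rw [Set.indicator_of_notMem hg]
      simp only [Set.mem_univ_pi, not_forall] at hg
      obtain ⟨i, hi⟩ := hg
      exact (Finset.prod_eq_zero (Finset.mem_univ i) (Set.indicator_of_notMem hi _)).symm
  simp only [h]
  have hm : ∀ i, Measurable ((s i).indicator (φ i)) := fun i => (hφ i).indicator (hs i)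
  rw [lintegral_prod_eq_prod_lintegral_of_indepFun Finset.univ
    (fun i (g : ι → X) => (s i).indicator (φ i) (g i))
    (iIndepFun_pi fun i => (hm i).aemeasurable) fun i => (hm i).comp (measurable_pi_apply i)]
  refine Finset.prod_congr rfl fun i _ => ?_
  rw [withDensity_apply _ (hs i), ← lintegral_indicator (hs i)]
  exact (measurePreserving_eval (fun _ : ι => μ) i).lintegral_comp (hm i)

/-! ### Laws of holonomies -/

theorem measurable_holonomy (e : Edge) : Measurable fun A : GenConn => A.1 e :=
  (measurable_pi_apply e).comp measurable_subtype_coe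

theorem measurable_proj (γ : Graph) : Measurable (proj γ) :=
  measurable_pi_lambda _ fun e => measurable_holonomy e

/-- The graph with a single edge. -/
def Graph.single (e : Edge) : Graph where
  edges := {e}
  inter _ h₁ _ h₂ hne :=
    absurd ((Finset.mem_singleton.mp h₁).trans (Finset.mem_singleton.mp h₂).symm) hne

instance uniqueSingle (e : Edge) : Unique (Graph.single e).edges :=
  inferInstanceAs (Unique ({e} : Finset Edge))

theorem coe_single (e : Edge) (i : (Graph.single e).edges) : (i : Edge) = e :=
  Finset.mem_singleton.mp i.2

open Classical in
/-- The graph with two edges that intersect in endpoints only. -/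
def Graph.pair (e e' : Edge) (h : e.image ∩ e'.image ⊆ e.endpoints ∩ e'.endpoints) : Graph where
  edges := {e, e'}
  inter e₁ h₁ e₂ h₂ hne := by
    simp only [Finset.mem_insert, Finset.mem_singleton] at h₁ h₂
    rcases h₁ with rfl | rfl <;> rcases h₂ with rfl | rfl
    · exact absurd rfl hne
    · exact h
    · rw [Set.inter_comm, Set.inter_comm (Edge.endpoints _)]; exact h
    · exact absurd rfl hne

/-- The holonomies along the edges of a graph are independent under a factorizing measure. -/
theorem IsFactorizing.map_proj_eq_pi {μ : Measure GenConn} [IsProbabilityMeasure μ]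
    (hfac : IsFactorizing μ) (γ : Graph) :
    μ.map (proj γ) = Measure.pi fun e : γ.edges => μ.map fun A : GenConn => A.1 e := by
  obtain ⟨f, φ, hf, hprod⟩ := hfac
  -- Regularity is assumed for `f` only; on a single-edge graph the factor `φ e` is the density
  -- itself and inherits it.
  have hφ : ∀ e, Measurable (φ e) := by
    intro e
    have h : φ e = fun z => f (Graph.single e) fun _ => z := by
      funext z
      rw [hprod, Fintype.prod_unique, coe_single]
    rw [h]
    exact (hf.measurable _).comp (measurable_pi_lambda _ fun _ => measurable_id)
  have hφ0 : ∀ e z, 0 ≤ φ e z := by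
    intro e z
    have h := hf.nonneg (Graph.single e) fun _ => z
    rwa [hprod, Fintype.prod_unique, coe_single] at h
  have key : ∀ γ : Graph, μ.map (proj γ) = Measure.pi fun e : γ.edges =>
      haarU1.withDensity fun z => ENNReal.ofReal (φ e z) := by
    intro γ
    rw [hf.map_eq γ, ← withDensity_prod_eq_pi haarU1 fun e : γ.edges => (hφ e).ennreal_ofReal]
    congr 1
    funext g
    rw [hprod, ENNReal.ofReal_prod_of_nonneg fun (e : γ.edges) _ => hφ0 e (g e)]
  -- Single-edge graphs also normalize each factor, so each marginal of the product is exactly its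
  -- factor.
  have hprob : ∀ e, IsProbabilityMeasure (haarU1.withDensity fun z => ENNReal.ofReal (φ e z)) := by
    intro e
    have h : (μ.map (proj (Graph.single e))) Set.univ = 1 := by
      rw [Measure.map_apply (measurable_proj _) MeasurableSet.univ]; simp
    rw [key, Measure.pi_univ, Fintype.prod_unique, coe_single] at h
    exact ⟨h⟩
  rw [key γ]
  congr 1
  funext e
  have h : (fun A : GenConn => A.1 e) = Function.eval e ∘ proj γ := rfl
  rw [h, ← Measure.map_map (measurable_pi_apply e) (measurable_proj γ), key γ,
    (measurePreserving_eval _ e).map_eq]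

theorem IsFactorizing.integral_mul {μ : Measure GenConn} [IsProbabilityMeasure μ]
    (hfac : IsFactorizing μ) {e e' : Edge} (hne : e ≠ e')
    (hinter : e.image ∩ e'.image ⊆ e.endpoints ∩ e'.endpoints) {c c' : Circle → ℂ}
    (hc : Measurable c) (hc' : Measurable c') :
    ∫ A : GenConn, c (A.1 e) * c' (A.1 e') ∂μ =
      (∫ A : GenConn, c (A.1 e) ∂μ) * ∫ A : GenConn, c' (A.1 e') ∂μ := by
  have hind : iIndepFun (fun (i : (Graph.pair e e' hinter).edges) (A : GenConn) => A.1 i) μ :=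
    (iIndepFun_iff_map_fun_eq_pi_map fun i : (Graph.pair e e' hinter).edges =>
      (measurable_holonomy i).aemeasurable).mpr (hfac.map_proj_eq_pi _)
  have hmem : e ∈ (Graph.pair e e' hinter).edges := by simp [Graph.pair]
  have hmem' : e' ∈ (Graph.pair e e' hinter).edges := by simp [Graph.pair]
  have h2 := hind.indepFun (i := ⟨e, hmem⟩) (j := ⟨e', hmem'⟩) (by simpa using hne)
  exact (h2.comp hc hc').integral_fun_mul_eq_mul_integral
    (hc.comp (measurable_holonomy e)).aestronglyMeasurable
    (hc'.comp (measurable_holonomy e')).aestronglyMeasurable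

/-- Vanishing Fourier coefficients make each single holonomy Haar distributed; independence does the
rest. -/
theorem IsFactorizing.isAshtekarLewandowski {μ : Measure GenConn} [IsProbabilityMeasure μ]
    (hfac : IsFactorizing μ)
    (h : ∀ (e : Edge) (m : ℤ), m ≠ 0 → ∫ A : GenConn, ((A.1 e ^ m : Circle) : ℂ) ∂μ = 0) :
    IsAshtekarLewandowski μ := by
  have hlaw : ∀ e : Edge, μ.map (fun A : GenConn => A.1 e) = haarU1 := by
    intro e
    have := Measure.isProbabilityMeasure_map (μ := μ) (measurable_holonomy e).aemeasurable
    refine eq_haarU1_of_integral_zpow_eq_zero _ fun m hm => ?_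
    rw [integral_map (measurable_holonomy e).aemeasurable
      (continuous_coe_zpow m).aestronglyMeasurable]
    exact h e m hm
  refine ⟨fun γ => measurable_const, fun γ g => zero_le_one, fun γ => ?_⟩
  rw [hfac.map_proj_eq_pi γ]
  simp [hlaw]

theorem IsEuclideanInvariant.integral_map_eq {μ : Measure GenConn} (hE : IsEuclideanInvariant μ)
    {T : E3 ≃ᵃⁱ[ℝ] E3}
    (hT : LinearMap.det (T.linearIsometryEquiv.toLinearEquiv : E3 →ₗ[ℝ] E3) = 1) (e : Edge)
    {c : Circle → ℂ} (hc : Continuous c) :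
    ∫ A : GenConn, c (A.1 (e.map T)) ∂μ = ∫ A : GenConn, c (A.1 e) ∂μ :=
  (hE T hT (Graph.single e) (fun g => c (g default)) (by fun_prop)).symm

/-! ### Rotations -/

theorem exists_ne_zero_inner_eq_zero (n : E3) : ∃ w : E3, w ≠ 0 ∧ inner ℝ n w = 0 := by
  have h : (ℝ ∙ n)ᗮ ≠ ⊥ := by
    intro h
    have h1 := (ℝ ∙ n).finrank_add_finrank_orthogonal
    rw [h, finrank_bot, finrank_euclideanSpace_fin] at h1
    have h2 := finrank_span_le_card (R := ℝ) ({n} : Set E3)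
    rw [Set.toFinset_singleton, Finset.card_singleton] at h2
    omega
  obtain ⟨w, hw, hw0⟩ := Submodule.exists_mem_ne_zero_of_ne_bot h
  exact ⟨w, hw0, Submodule.mem_orthogonal_singleton_iff_inner_right.mp hw⟩

/-- Reflection in a line of three-space is a half-turn: it negates a plane, and `(-1)² = 1`. -/
theorem det_reflection_span_singleton {u : E3} (hu : u ≠ 0) :
    LinearMap.det ((ℝ ∙ u).reflection.toLinearEquiv : E3 →ₗ[ℝ] E3) = 1 := by
  have : Fact (Module.finrank ℝ E3 = 2 + 1) := ⟨finrank_euclideanSpace_fin⟩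
  have h := (ℝ ∙ u).det_reflection
  rw [Submodule.finrank_orthogonal_span_singleton (n := 2) hu] at h
  simpa using h

/-- Rotations act transitively on spheres. -/
theorem exists_rotation {a b : E3} (hab : ‖a‖ = ‖b‖) :
    ∃ L : E3 ≃ₗᵢ[ℝ] E3, LinearMap.det (L.toLinearEquiv : E3 →ₗ[ℝ] E3) = 1 ∧ L a = b := by
  by_cases h : a + b = 0
  -- Antipodal case: a half-turn about any axis orthogonal to `a`.
  · obtain ⟨w, hw0, hw⟩ := exists_ne_zero_inner_eq_zero a
    refine ⟨(ℝ ∙ w).reflection, det_reflection_span_singleton hw0, ?_⟩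
    rw [Submodule.reflection_mem_subspace_orthogonalComplement_eq_neg
      (Submodule.mem_orthogonal_singleton_iff_inner_left.mpr hw)]
    exact neg_eq_of_add_eq_zero_right h
  -- The half-turn about the bisector `a + b` exchanges `a` and `b`.
  · refine ⟨(ℝ ∙ (a + b)).reflection, det_reflection_span_singleton h, ?_⟩
    have h1 := Submodule.reflection_sub (v := a) (w := -b) (by rw [norm_neg, hab])
    rw [sub_neg_eq_add, Submodule.reflection_orthogonal_apply] at h1
    exact neg_injective h1

/-- The motion `x ↦ b + L x`. -/
def rigidMotion (L : E3 ≃ₗᵢ[ℝ] E3) (b : E3) : E3 ≃ᵃⁱ[ℝ] E3 :=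
  L.toAffineIsometryEquiv.trans (AffineIsometryEquiv.constVAdd ℝ E3 b)

theorem rigidMotion_apply (L : E3 ≃ₗᵢ[ℝ] E3) (b x : E3) : rigidMotion L b x = b + L x := rfl

theorem linearIsometryEquiv_rigidMotion (L : E3 ≃ₗᵢ[ℝ] E3) (b : E3) :
    (rigidMotion L b).linearIsometryEquiv = L := by
  ext1 x
  have h := (rigidMotion L b).map_vadd 0 x
  simp only [rigidMotion_apply, vadd_eq_add, add_zero, map_zero] at h
  rw [add_comm] at h
  exact (add_right_cancel h).symm

/-! ### Pieces of edges -/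

namespace Edge

/-- The part of an edge between the parameters `a` and `b`. -/
def piece (e : Edge) (a b : ℝ) (ha : 0 ≤ a) (hab : a < b) (hb : b ≤ 1) : Edge where
  toFun t := e.toFun (a + (b - a) * t)
  analytic t ht := by
    have h : AnalyticAt ℝ e.toFun (a + (b - a) * t) :=
      e.analytic _ ⟨by nlinarith [ht.1], by nlinarith [ht.2]⟩
    exact h.comp (f := fun t => a + (b - a) * t)
      (analyticAt_const.add (analyticAt_const.mul analyticAt_id))
  deriv_ne_zero t ht := by
    have ht' : a + (b - a) * t ∈ Set.Icc (0 : ℝ) 1 := ⟨by nlinarith [ht.1], by nlinarith [ht.2]⟩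
    have h := (e.hasDerivAt ht').scomp t (((hasDerivAt_id t).const_mul (b - a)).const_add a)
    have h' := h.deriv
    simp only [Function.comp_def, id, mul_one] at h'
    rw [h']
    exact smul_ne_zero (sub_pos.mpr hab).ne' (e.deriv_ne_zero _ ht')
  injective s hs t ht hst h := by
    have hba := sub_pos.mpr hab
    have h1 := mul_nonneg hba.le hs.1
    have h2 := mul_le_mul_of_nonneg_left ht.2 hba.le
    have h3 := mul_lt_mul_of_pos_left hst hba
    obtain ⟨h4, h5⟩ := e.injective _ ⟨by linarith, by linarith⟩ _ ⟨by linarith, by linarith⟩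
      (by linarith) h
    constructor
    · exact (mul_eq_zero.mp (by linarith : (b - a) * s = 0)).resolve_left hba.ne'
    · exact mul_left_cancel₀ hba.ne' (by linarith : (b - a) * t = (b - a) * 1)

variable (e : Edge) {a b : ℝ} (ha : 0 ≤ a) (hab : a < b) (hb : b ≤ 1)

theorem piece_apply (t : ℝ) : (e.piece a b ha hab hb).toFun t = e.toFun (a + (b - a) * t) := rfl

theorem endpoints_piece : (e.piece a b ha hab hb).endpoints = {e.toFun a, e.toFun b} := by
  rw [endpoints, piece_apply, piece_apply, mul_zero, add_zero, mul_one, add_sub_cancel]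

theorem deriv_piece {t : ℝ} (ht : t ∈ Set.Icc (0 : ℝ) 1) :
    deriv (e.piece a b ha hab hb).toFun t = (b - a) • deriv e.toFun (a + (b - a) * t) := by
  have ht' : a + (b - a) * t ∈ Set.Icc (0 : ℝ) 1 := ⟨by nlinarith [ht.1], by nlinarith [ht.2]⟩
  have h := (e.hasDerivAt ht').scomp t (((hasDerivAt_id t).const_mul (b - a)).const_add a)
  rw [mul_one] at h
  exact h.deriv

theorem deriv_map (T : E3 ≃ᵃⁱ[ℝ] E3) {t : ℝ} (ht : t ∈ Set.Icc (0 : ℝ) 1) :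
    deriv (e.map T).toFun t = T.linearIsometryEquiv (deriv e.toFun t) := by
  have h : (e.map T).toFun =
      fun t => T.linearIsometryEquiv.toContinuousLinearEquiv.toContinuousLinearMap (e.toFun t)
        + T 0 := by
    funext s
    have hs := T.map_vadd 0 (e.toFun s)
    rw [vadd_eq_add, vadd_eq_add, add_zero] at hs
    exact hs
  rw [h]
  exact (((T.linearIsometryEquiv.toContinuousLinearEquiv.toContinuousLinearMap).hasFDerivAt
    |>.comp_hasDerivAt t (e.hasDerivAt ht)).add_const (T 0)).deriv

theorem isComposition_piece {r : ℝ} (hr0 : 0 < r) (hr1 : r < 1) :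
    e.IsComposition (e.piece 0 r le_rfl hr0 hr1.le) (e.piece r 1 hr0.le hr1 le_rfl) :=
  ⟨r, ⟨hr0, hr1⟩, fun t _ => by simp [piece], fun t _ => rfl⟩

theorem piece_ne_piece {r : ℝ} (hr0 : 0 < r) (hr1 : r < 1) :
    e.piece 0 r le_rfl hr0 hr1.le ≠ e.piece r 1 hr0.le hr1 le_rfl := by
  intro h
  have h0 : e.toFun 0 = e.toFun r := by
    simpa [piece] using congrArg (fun e : Edge => e.toFun 0) h
  exact hr1.ne (e.injective 0 ⟨le_rfl, zero_le_one⟩ r ⟨hr0.le, hr1.le⟩ hr0 h0).2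

/-- The pieces share the subdivision point and, for a loop, also the base point; both are endpoints
of both pieces. -/
theorem image_piece_inter_image_piece {r : ℝ} (hr0 : 0 < r) (hr1 : r < 1) :
    (e.piece 0 r le_rfl hr0 hr1.le).image ∩ (e.piece r 1 hr0.le hr1 le_rfl).image ⊆
      (e.piece 0 r le_rfl hr0 hr1.le).endpoints ∩ (e.piece r 1 hr0.le hr1 le_rfl).endpoints := by
  rintro x ⟨⟨s, hs, rfl⟩, t, ht, hst⟩
  simp only [endpoints_piece, piece_apply, zero_add, sub_zero] at hst ⊢
  have h1 : r * s ≤ r := by nlinarith [hs.2]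
  have h2 : r ≤ r + (1 - r) * t := by nlinarith [ht.1]
  rcases eq_or_lt_of_le (h1.trans h2) with h | h
  · have hsr : r * s = r := by linarith
    rw [hsr]
    exact ⟨Or.inr rfl, Or.inl rfl⟩
  · obtain ⟨h3, h4⟩ := e.injective _ ⟨mul_nonneg hr0.le hs.1, by linarith⟩ _
      ⟨by linarith, by nlinarith [ht.2]⟩ h hst.symm
    rw [h3, h4] at hst
    rw [h3]
    exact ⟨Or.inl rfl, Or.inr hst.symm⟩

/-- Used for a defining function of the surface, to count crossings, and for a linear height, to
separate translates. -/
theorem strictMonoOn_comp {g : E3 → ℝ} {n : E3 → E3}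
    (hg : ∀ t ∈ Set.Icc (0 : ℝ) 1, HasGradientAt g (n (e.toFun t)) (e.toFun t))
    (hpos : ∀ t ∈ Set.Icc (0 : ℝ) 1, 0 < inner ℝ (n (e.toFun t)) (deriv e.toFun t)) :
    StrictMonoOn (fun t => g (e.toFun t)) (Set.Icc 0 1) := by
  have hd : ∀ t ∈ Set.Icc (0 : ℝ) 1, HasDerivAt (fun t => g (e.toFun t))
      (inner ℝ (n (e.toFun t)) (deriv e.toFun t)) t := fun t ht => by
    have h := (hg t ht).hasFDerivAt.comp_hasDerivAt t (e.hasDerivAt ht)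
    rw [InnerProductSpace.toDual_apply_apply] at h
    exact h
  refine strictMonoOn_of_deriv_pos (convex_Icc 0 1)
    (fun t ht => (hd t ht).continuousAt.continuousWithinAt) fun t ht => ?_
  have ht' := interior_subset ht
  rw [(hd t ht').deriv]
  exact hpos t ht'

end Edge

/-! ### Edges crossing a surface -/

theorem hasGradientAt_of_analyticOnNhd {g : E3 → ℝ} {U : Set E3} (hg : AnalyticOnNhd ℝ g U)
    {x : E3} (hx : x ∈ U) : HasGradientAt g (∇ g x) x :=
  (hg x hx).differentiableAt.hasGradientAt

/-- An edge that traverses a coordinate patch of a surface from the negative to the positive side,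
nowhere tangential to the level surfaces, crosses the surface exactly once. -/
theorem Surface.intersectionNumber_eq_one (S : Surface) (e : Edge) {U : Set E3} {g : E3 → ℝ}
    (hg : AnalyticOnNhd ℝ g U) (hcar : S.carrier ∩ U = {x ∈ U | g x = 0})
    (hn : ∀ x ∈ S.carrier ∩ U, S.normal x = ‖∇ g x‖⁻¹ • ∇ g x)
    (heU : ∀ t ∈ Set.Icc (0 : ℝ) 1, e.toFun t ∈ U)
    (hpos : ∀ t ∈ Set.Icc (0 : ℝ) 1, 0 < inner ℝ (∇ g (e.toFun t)) (deriv e.toFun t))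
    (h0 : g (e.toFun 0) < 0) (h1 : 0 < g (e.toFun 1)) :
    (S.crossings e).Finite ∧ S.intersectionNumber e = 1 := by
  have hgrad : ∀ t ∈ Set.Icc (0 : ℝ) 1, HasGradientAt g (∇ g (e.toFun t)) (e.toFun t) :=
    fun t ht => hasGradientAt_of_analyticOnNhd hg (heU t ht)
  have hmono := e.strictMonoOn_comp hgrad hpos
  have hcont : ContinuousOn (fun t => g (e.toFun t)) (Set.Icc 0 1) := fun t ht =>
    ((hg _ (heU t ht)).continuousAt.comp (e.analytic t ht).continuousAt).continuousWithinAt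
  obtain ⟨t₀, ht₀, hgt₀⟩ := intermediate_value_Icc zero_le_one hcont ⟨h0.le, h1.le⟩
  have hmem : ∀ t ∈ Set.Icc (0 : ℝ) 1, (e.toFun t ∈ S.carrier ↔ g (e.toFun t) = 0) := by
    intro t ht
    have h := Set.ext_iff.mp hcar (e.toFun t)
    simpa [heU t ht] using h
  have hsign : ∀ t ∈ Set.Icc (0 : ℝ) 1, e.toFun t ∈ S.carrier → S.orientationSign e t = 1 := by
    intro t ht hS
    have h := hpos t ht
    have hne : ∇ g (e.toFun t) ≠ 0 := fun h0 => by simp [h0] at h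
    rw [Surface.orientationSign, hn _ ⟨hS, heU t ht⟩, real_inner_smul_left]
    exact Real.sign_of_pos (mul_pos (inv_pos.mpr (norm_pos_iff.mpr hne)) h)
  have hcross : S.crossings e = {t₀} := by
    ext t
    constructor
    · rintro ⟨ht, hS, -⟩
      exact hmono.injOn ht ht₀ (((hmem t ht).mp hS).trans hgt₀.symm)
    · rintro rfl
      have hS := (hmem _ ht₀).mpr hgt₀
      exact ⟨ht₀, hS, by rw [hsign _ ht₀ hS]; exact one_ne_zero⟩
  -- The crossing is at an interior parameter, so its weight is `1` and not `1 / 2`.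
  have hne0 : t₀ ≠ 0 := by rintro rfl; exact h0.ne hgt₀
  have hne1 : t₀ ≠ 1 := by rintro rfl; exact h1.ne' hgt₀
  refine ⟨hcross ▸ Set.finite_singleton _, ?_⟩
  rw [Surface.intersectionNumber, hcross, finsum_mem_singleton,
    hsign _ ht₀ ((hmem _ ht₀).mpr hgt₀)]
  simp [hne0, hne1]

theorem continuousAt_gradient {g : E3 → ℝ} {x : E3} (hg : AnalyticAt ℝ g x) :
    ContinuousAt (∇ g) x :=
  ((InnerProductSpace.toDual ℝ E3).symm.continuous.continuousAt).comp hg.fderiv.continuousAt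

theorem exists_rotation_inner_pos {a n : E3} (ha : a ≠ 0) (hn : n ≠ 0) :
    ∃ L : E3 ≃ₗᵢ[ℝ] E3, LinearMap.det (L.toLinearEquiv : E3 →ₗ[ℝ] E3) = 1 ∧
      0 < inner ℝ n (L a) := by
  have ha' := norm_pos_iff.mpr ha
  have hn' := norm_pos_iff.mpr hn
  obtain ⟨L, hL, hLa⟩ := exists_rotation (a := ‖a‖⁻¹ • a) (b := ‖n‖⁻¹ • n) (by
    rw [norm_smul, norm_inv, norm_norm, inv_mul_cancel₀ ha'.ne', norm_smul, norm_inv, norm_norm,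
      inv_mul_cancel₀ hn'.ne'])
  refine ⟨L, hL, ?_⟩
  have h : L a = (‖a‖ * ‖n‖⁻¹) • n := by
    rw [mul_smul, ← hLa, ← map_smul, smul_smul, mul_inv_cancel₀ ha'.ne', one_smul]
  rw [h, real_inner_smul_right, real_inner_self_eq_norm_sq]
  positivity

/-- A short initial piece of an edge, rotated suitably, is transversal to the level surfaces of a
function near a regular point. -/
theorem exists_piece_transversal (e : Edge) {g : E3 → ℝ} {U : Set E3} (hUo : IsOpen U)
    (hg : AnalyticOnNhd ℝ g U) {p : E3} (hp : p ∈ U) {L : E3 ≃ₗᵢ[ℝ] E3}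
    (hL : 0 < inner ℝ (∇ g p) (L (deriv e.toFun 0))) :
    ∃ (δ r : ℝ) (hr0 : 0 < r) (hr1 : r < 1), 0 < δ ∧ Metric.ball p δ ⊆ U ∧
      (∀ x ∈ Metric.ball p δ, ∀ t ∈ Set.Icc (0 : ℝ) 1,
        0 < inner ℝ (∇ g x) (L (deriv (e.piece 0 r le_rfl hr0 hr1.le).toFun t))) ∧
      ∀ t ∈ Set.Icc (0 : ℝ) 1, dist ((e.piece 0 r le_rfl hr0 hr1.le).toFun t)
        ((e.piece 0 r le_rfl hr0 hr1.le).toFun (1 / 2)) < δ / 2 := by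
  have h01 : (0 : ℝ) ∈ Set.Icc (0 : ℝ) 1 := ⟨le_rfl, zero_le_one⟩
  -- The point and the parameter vary independently, so positivity will hold for every translate
  -- staying in the ball.
  have hcont : ContinuousAt (fun q : E3 × ℝ => inner ℝ (∇ g q.1) (L (deriv e.toFun q.2))) (p, 0) := by
    have h1 : ContinuousAt (fun q : E3 × ℝ => ∇ g q.1) (p, 0) :=
      ContinuousAt.comp (g := ∇ g) (continuousAt_gradient (hg p hp)) continuousAt_fst
    have h2 : ContinuousAt (fun q : E3 × ℝ => deriv e.toFun q.2) (p, 0) :=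
      ContinuousAt.comp (g := deriv e.toFun) (e.analytic 0 h01).deriv.continuousAt continuousAt_snd
    exact h1.inner (𝕜 := ℝ) (L.continuous.continuousAt.comp h2)
  have hev : ∀ᶠ q : E3 × ℝ in nhds (p, 0),
      0 < inner ℝ (∇ g q.1) (L (deriv e.toFun q.2)) ∧ q.1 ∈ U :=
    (hcont.eventually_const_lt hL).and (continuousAt_fst.eventually (hUo.mem_nhds hp))
  obtain ⟨δ, hδ, hball⟩ := Metric.eventually_nhds_iff.mp hev
  -- Points within `δ / 4` of the start are within `δ / 2` of the midpoint of the piece.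
  obtain ⟨δ', hδ', hball'⟩ := Metric.continuousAt_iff.mp (e.analytic 0 h01).continuousAt (δ / 4)
    (by positivity)
  obtain ⟨r, hr0, hr⟩ := exists_between (lt_min (lt_min hδ hδ') one_pos)
  have hr1 : r < 1 := hr.trans_le (min_le_right _ _)
  have hrδ : r < δ := hr.trans_le ((min_le_left _ _).trans (min_le_left _ _))
  have hrδ' : r < δ' := hr.trans_le ((min_le_left _ _).trans (min_le_right _ _))
  have hdist : ∀ t ∈ Set.Icc (0 : ℝ) 1, dist (r * t) 0 ≤ r := by
    intro t ht
    rw [Real.dist_eq, sub_zero, abs_of_nonneg (mul_nonneg hr0.le ht.1)]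
    nlinarith [ht.2]
  have hclose : ∀ t ∈ Set.Icc (0 : ℝ) 1, dist (e.toFun (r * t)) (e.toFun 0) < δ / 4 :=
    fun t ht => hball' ((hdist t ht).trans_lt hrδ')
  refine ⟨δ, r, hr0, hr1, hδ, fun x hx => ?_, fun x hx t ht => ?_, fun t ht => ?_⟩
  · refine (hball (y := (x, 0)) ?_).2
    rw [Prod.dist_eq]
    exact max_lt hx (by rw [dist_self]; exact hδ)
  · rw [Edge.deriv_piece _ _ _ _ ht, zero_add, sub_zero, map_smul, real_inner_smul_right]
    refine mul_pos hr0 (hball (y := (x, r * t)) ?_).1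
    rw [Prod.dist_eq]
    exact max_lt hx ((hdist t ht).trans_lt hrδ)
  · simp only [Edge.piece_apply, zero_add, sub_zero]
    have h1 := hclose t ht
    have h2 := hclose (1 / 2) ⟨by norm_num, by norm_num⟩
    have h3 := dist_triangle_right (e.toFun (r * t)) (e.toFun (r * (1 / 2))) (e.toFun 0)
    linarith

/-- The edge `e`, rotated by `L` and translated so that its midpoint is at `p + v`. -/
def Edge.placeAt (e : Edge) (L : E3 ≃ₗᵢ[ℝ] E3) (p v : E3) : Edge :=
  e.map (rigidMotion L (v + (p - L (e.toFun (1 / 2)))))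

theorem Edge.placeAt_apply (e : Edge) (L : E3 ≃ₗᵢ[ℝ] E3) (p v : E3) (t : ℝ) :
    (e.placeAt L p v).toFun t = v + (p + L (e.toFun t - e.toFun (1 / 2))) := by
  change rigidMotion L _ (e.toFun t) = _
  rw [rigidMotion_apply, map_sub]
  abel

theorem Edge.deriv_placeAt (e : Edge) (L : E3 ≃ₗᵢ[ℝ] E3) (p v : E3) {t : ℝ}
    (ht : t ∈ Set.Icc (0 : ℝ) 1) : deriv (e.placeAt L p v).toFun t = L (deriv e.toFun t) := by
  rw [Edge.placeAt, Edge.deriv_map _ _ ht, linearIsometryEquiv_rigidMotion]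

/-- The height `⟨n, ·⟩` is strictly increasing along the edge and unchanged by the shifts, so a
common point has equal parameters on both copies, forcing equal shifts. -/
theorem Edge.disjoint_image_placeAt (e : Edge) (L : E3 ≃ₗᵢ[ℝ] E3) (p : E3) {n v v' : E3}
    (hpos : ∀ t ∈ Set.Icc (0 : ℝ) 1, 0 < inner ℝ n (L (deriv e.toFun t)))
    (hv : inner ℝ n v = 0) (hv' : inner ℝ n v' = 0) (hne : v ≠ v') :
    Disjoint (e.placeAt L p v).image (e.placeAt L p v').image := by
  rw [Set.disjoint_left]
  rintro x ⟨t, ht, rfl⟩ ⟨t', ht', hx⟩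
  have hlin := (e.placeAt L p 0).strictMonoOn_comp (g := fun x => inner ℝ n x) (n := fun _ => n)
    (fun t _ => by
      rw [hasGradientAt_iff_hasFDerivAt]
      exact (InnerProductSpace.toDual ℝ E3 n).hasFDerivAt)
    (fun t ht => by rw [Edge.deriv_placeAt _ _ _ _ ht]; exact hpos t ht)
  have hsplit : ∀ v t, (e.placeAt L p v).toFun t = v + (e.placeAt L p 0).toFun t := by
    intro v t
    rw [Edge.placeAt_apply, Edge.placeAt_apply, zero_add]
  rw [hsplit, hsplit v] at hx
  have hi := congrArg (fun y => inner ℝ n y) hx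
  simp only [inner_add_right, hv, hv', zero_add] at hi
  rw [hlin.injOn ht' ht hi] at hx
  exact hne (add_right_cancel hx).symm

/-- For `v = 0` the midpoint lies at `p`, so by monotonicity `g` is negative at the start and
positive at the end. These signs persist for small `v`, and `‖v‖ < δ / 2` keeps the edge in the
ball. -/
theorem eventually_placeAt_crossing (S : Surface) (e : Edge) {U : Set E3} {g : E3 → ℝ}
    (hg : AnalyticOnNhd ℝ g U) (hcar : S.carrier ∩ U = {x ∈ U | g x = 0})
    (hn : ∀ x ∈ S.carrier ∩ U, S.normal x = ‖∇ g x‖⁻¹ • ∇ g x) {L : E3 ≃ₗᵢ[ℝ] E3} {p : E3}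
    (hgp : g p = 0) {δ : ℝ} (hδ : 0 < δ) (hU : Metric.ball p δ ⊆ U)
    (hpos : ∀ x ∈ Metric.ball p δ, ∀ t ∈ Set.Icc (0 : ℝ) 1,
      0 < inner ℝ (∇ g x) (L (deriv e.toFun t)))
    (hclose : ∀ t ∈ Set.Icc (0 : ℝ) 1, dist (e.toFun t) (e.toFun (1 / 2)) < δ / 2) :
    ∀ᶠ v in nhds (0 : E3), (S.crossings (e.placeAt L p v)).Finite ∧
      S.intersectionNumber (e.placeAt L p v) = 1 := by
  have h01 : (0 : ℝ) ∈ Set.Icc (0 : ℝ) 1 := ⟨le_rfl, zero_le_one⟩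
  have h11 : (1 : ℝ) ∈ Set.Icc (0 : ℝ) 1 := ⟨zero_le_one, le_rfl⟩
  have hhalf_mem : (1 / 2 : ℝ) ∈ Set.Icc (0 : ℝ) 1 := ⟨by norm_num, by norm_num⟩
  have hnear : ∀ v : E3, ‖v‖ < δ / 2 → ∀ t ∈ Set.Icc (0 : ℝ) 1,
      (e.placeAt L p v).toFun t ∈ Metric.ball p δ := by
    intro v hv t ht
    have h3 := hclose t ht
    rw [dist_eq_norm] at h3
    rw [Metric.mem_ball, dist_eq_norm, Edge.placeAt_apply,
      show v + (p + L (e.toFun t - e.toFun (1 / 2))) - p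
        = v + L (e.toFun t - e.toFun (1 / 2)) by abel]
    have h4 := norm_add_le v (L (e.toFun t - e.toFun (1 / 2)))
    rw [L.norm_map] at h4
    linarith
  have hpos' : ∀ v : E3, ‖v‖ < δ / 2 → ∀ t ∈ Set.Icc (0 : ℝ) 1,
      0 < inner ℝ (∇ g ((e.placeAt L p v).toFun t)) (deriv (e.placeAt L p v).toFun t) := by
    intro v hv t ht
    rw [Edge.deriv_placeAt _ _ _ _ ht]
    exact hpos _ (hnear v hv t ht) t ht
  have h0 : ‖(0 : E3)‖ < δ / 2 := by rw [norm_zero]; exact half_pos hδ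
  have hmono := (e.placeAt L p 0).strictMonoOn_comp
    (fun t ht => hasGradientAt_of_analyticOnNhd hg (hU (hnear 0 h0 t ht))) (hpos' 0 h0)
  have hhalf : g ((e.placeAt L p 0).toFun (1 / 2)) = 0 := by
    rw [Edge.placeAt_apply, sub_self, map_zero, add_zero, zero_add, hgp]
  have hneg : g ((e.placeAt L p 0).toFun 0) < 0 := hhalf ▸ hmono h01 hhalf_mem (by norm_num)
  have hposi : 0 < g ((e.placeAt L p 0).toFun 1) := by
    have h := hmono hhalf_mem h11 (by norm_num)
    simp only [hhalf] at h
    exact h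
  have hct : ∀ t ∈ Set.Icc (0 : ℝ) 1,
      ContinuousAt (fun v => g ((e.placeAt L p v).toFun t)) 0 := by
    intro t ht
    refine ContinuousAt.comp (f := fun v => (e.placeAt L p v).toFun t)
      (hg _ (hU (hnear 0 h0 t ht))).continuousAt ?_
    simp only [Edge.placeAt_apply]
    exact continuousAt_id.add continuousAt_const
  filter_upwards [(hct 0 h01).eventually_lt_const hneg, (hct 1 h11).eventually_const_lt hposi,
    continuous_norm.continuousAt.eventually_lt_const h0] with v h1 h2 h3
  exact S.intersectionNumber_eq_one _ hg hcar hn (fun t ht => hU (hnear v h3 t ht)) (hpos' v h3)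
    h1 h2

/-- Every edge has an initial piece which has infinitely many disjoint congruent copies crossing the
given surface exactly once. -/
theorem exists_disjoint_crossing_copies (S : Surface) (e : Edge) :
    ∃ (r : ℝ) (hr0 : 0 < r) (hr1 : r < 1) (T : ℕ → E3 ≃ᵃⁱ[ℝ] E3),
      (∀ k, LinearMap.det ((T k).linearIsometryEquiv.toLinearEquiv : E3 →ₗ[ℝ] E3) = 1) ∧
      (∀ k, (S.crossings ((e.piece 0 r le_rfl hr0 hr1.le).map (T k))).Finite ∧
        S.intersectionNumber ((e.piece 0 r le_rfl hr0 hr1.le).map (T k)) = 1) ∧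
      ∀ j k, j ≠ k → Disjoint ((e.piece 0 r le_rfl hr0 hr1.le).map (T j)).image
        ((e.piece 0 r le_rfl hr0 hr1.le).map (T k)).image := by
  have := S.simplyConnected
  -- Simple connectedness includes nonemptiness, which supplies the base point.
  obtain ⟨p, hp⟩ := (inferInstance : Nonempty S.carrier)
  obtain ⟨U, g, hUo, hpU, hg, hne, hcar, hnormal⟩ := S.embedded p hp
  have hgp : g p = 0 := (hcar ▸ (⟨hp, hpU⟩ : p ∈ S.carrier ∩ U) : p ∈ {x ∈ U | g x = 0}).2
  obtain ⟨L, hL, hLpos⟩ := exists_rotation_inner_pos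
    (e.deriv_ne_zero 0 ⟨le_rfl, zero_le_one⟩) (hne p hpU)
  obtain ⟨δ, r, hr0, hr1, hδ, hball, hpos, hclose⟩ :=
    exists_piece_transversal e hUo hg hpU hLpos
  have hevv := eventually_placeAt_crossing S _ hg hcar hnormal hgp hδ hball hpos hclose
  obtain ⟨w, hw0, hw⟩ := exists_ne_zero_inner_eq_zero (∇ g p)
  have hsw : Filter.Tendsto (fun s : ℝ => s • w) (nhds 0) (nhds 0) := by
    have h : ContinuousAt (fun s : ℝ => s • w) 0 := continuousAt_id.smul continuousAt_const
    simpa [ContinuousAt] using h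
  obtain ⟨ε, hε, hεw⟩ := Metric.eventually_nhds_iff.mp (hsw.eventually hevv)
  -- With `k + 1` the bound would fail to be strict at `k = 0`.
  have hs : ∀ k : ℕ, dist (ε / (k + 2)) 0 < ε := by
    intro k
    have hk : (0 : ℝ) < k + 2 := by positivity
    rw [Real.dist_eq, sub_zero, abs_of_pos (div_pos hε hk), div_lt_iff₀ hk]
    nlinarith [(Nat.cast_nonneg k : (0 : ℝ) ≤ k)]
  have horth : ∀ k : ℕ, inner ℝ (∇ g p) ((ε / (k + 2)) • w) = 0 := fun k => by
    rw [real_inner_smul_right, hw, mul_zero]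
  refine ⟨r, hr0, hr1, fun k : ℕ => rigidMotion L ((ε / (k + 2)) • w +
    (p - L ((e.piece 0 r le_rfl hr0 hr1.le).toFun (1 / 2)))), fun k => ?_, fun k => hεw (hs k),
    fun j k hjk => ?_⟩
  · rw [linearIsometryEquiv_rigidMotion]
    exact hL
  · refine Edge.disjoint_image_placeAt _ L p (hpos p (Metric.mem_ball_self hδ)) (horth j) (horth k)
      fun h => hjk ?_
    have hj2 : (0 : ℝ) < j + 2 := by positivity
    have hk2 : (0 : ℝ) < k + 2 := by positivity
    have hss : ε / (j + 2) = ε / (k + 2) := smul_left_injective ℝ hw0 h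
    rw [div_eq_div_iff hj2.ne' hk2.ne'] at hss
    exact_mod_cast (add_right_cancel (mul_left_cancel₀ hε.ne' hss) : (k : ℝ) = j).symm

/-! ### The flux functional -/

/-- A vector with equal inner products with all the members of a bounded orthogonal sequence is
orthogonal to all of them. -/
theorem eq_zero_of_inner_eq_of_orthogonal {E : Type*} [NormedAddCommGroup E]
    [InnerProductSpace ℂ E] {v : ℕ → E} {F : E} {a : ℂ} {C : ℝ} (hC : ∀ k, ‖v k‖ ≤ C)
    (horth : ∀ j k, j ≠ k → inner ℂ (v j) (v k) = 0) (ha : ∀ k, inner ℂ (v k) F = a) : a = 0 := by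
  have hnorm : ∀ N : ℕ, ‖∑ k ∈ Finset.range N, v k‖ ^ 2 ≤ N * C ^ 2 := by
    intro N
    induction N with
    | zero => simp
    | succ N ih =>
      have h : inner ℂ (∑ k ∈ Finset.range N, v k) (v N) = 0 := by
        rw [sum_inner]
        exact Finset.sum_eq_zero fun k hk => horth k N (Finset.mem_range.mp hk).ne
      rw [Finset.sum_range_succ, norm_add_sq (𝕜 := ℂ), h]
      have h2 := pow_le_pow_left₀ (norm_nonneg (v N)) (hC N) 2
      simp only [map_zero, mul_zero, add_zero]
      push_cast
      linarith
  have hinner : ∀ N : ℕ, inner ℂ (∑ k ∈ Finset.range N, v k) F = N * a := by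
    intro N
    rw [sum_inner]
    simp [ha]
  by_contra h0
  have hapos : 0 < ‖a‖ ^ 2 := pow_pos (norm_pos_iff.mpr h0) 2
  -- Cauchy–Schwarz for the sum of `N` vectors gives `N² ‖a‖² ≤ N C² ‖F‖²`, which fails for this
  -- `N`.
  obtain ⟨N, hN⟩ := exists_nat_gt (C ^ 2 * ‖F‖ ^ 2 / ‖a‖ ^ 2)
  have hNpos : (0 : ℝ) < N := lt_of_le_of_lt (by positivity) hN
  rw [div_lt_iff₀ hapos] at hN
  have h1 := norm_inner_le_norm (𝕜 := ℂ) (∑ k ∈ Finset.range N, v k) F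
  rw [hinner, norm_mul, Complex.norm_natCast] at h1
  have h2 := pow_le_pow_left₀ (by positivity) h1 2
  rw [mul_pow, mul_pow] at h2
  have h3 := mul_le_mul_of_nonneg_right (hnorm N) (sq_nonneg ‖F‖)
  have h4 := mul_lt_mul_of_pos_left hN hNpos
  nlinarith

theorem eq_zero_of_integral_conj_mul_eq {Ω : Type*} [MeasurableSpace Ω] {μ : Measure Ω}
    [IsProbabilityMeasure μ] {X : ℕ → Ω → ℂ} {F : Ω → ℂ} {a : ℂ} {C : ℝ}
    (hX : ∀ k, Measurable (X k)) (hC : ∀ k x, ‖X k x‖ ≤ C) (hF : MemLp F 2 μ)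
    (horth : ∀ j k, j ≠ k → ∫ x, conj (X j x) * X k x ∂μ = 0)
    (ha : ∀ k, ∫ x, conj (X k x) * F x ∂μ = a) : a = 0 := by
  have hXL : ∀ k, MemLp (X k) 2 μ := fun k =>
    MemLp.of_bound (hX k).aestronglyMeasurable C (Filter.Eventually.of_forall (hC k))
  have hinner : ∀ {f g : Ω → ℂ} (hf : MemLp f 2 μ) (hg : MemLp g 2 μ),
      inner ℂ (hf.toLp f) (hg.toLp g) = ∫ x, conj (f x) * g x ∂μ := by
    intro f g hf hg
    rw [L2.inner_def]
    refine integral_congr_ae ?_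
    filter_upwards [hf.coeFn_toLp, hg.coeFn_toLp] with x h1 h2
    rw [h1, h2, RCLike.inner_apply, mul_comm]
  refine eq_zero_of_inner_eq_of_orthogonal (v := fun k => (hXL k).toLp (X k)) (F := hF.toLp F)
    (C := C) (fun k => ?_) (fun j k hjk => ?_) fun k => ?_
  · have hC0 : 0 ≤ C := (norm_nonneg _).trans (hC k
      (Classical.choice (nonempty_of_isProbabilityMeasure μ)))
    have h := Lp.norm_le_of_ae_bound (p := 2) (f := (hXL k).toLp (X k)) hC0 (by
      filter_upwards [(hXL k).coeFn_toLp] with x hx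
      rw [hx]
      exact hC k x)
    simpa [measureUnivNNReal, -Lp.norm_toLp] using h
  · rw [hinner]; exact horth j k hjk
  · rw [hinner]; exact ha k

theorem smoothOnTorus_zpow_sub {ι : Type*} [Fintype ι] (i : ι) (m : ℤ) (M : ℂ) :
    SmoothOnTorus fun g : ι → Circle => ((g i ^ m : Circle) : ℂ) - M := by
  have h : (fun θ : ι → ℝ => ((Circle.exp (θ i) ^ m : Circle) : ℂ) - M) =
      fun θ => Complex.exp (((m : ℝ) * θ i : ℝ) * Complex.I) - M := by
    funext θ
    rw [← Circle.exp_zsmul, Circle.coe_exp, zsmul_eq_mul]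
  unfold SmoothOnTorus
  rw [h]
  refine ContDiff.sub (ContDiff.cexp (ContDiff.mul ?_ contDiff_const)) contDiff_const
  exact Complex.ofRealCLM.contDiff.comp (contDiff_const.mul (contDiff_apply ℝ ℝ i))

theorem angleDeriv_zpow_sub {ι : Type*} [Fintype ι] (i : ι) (m : ℤ) (M : ℂ) (g : ι → Circle) :
    angleDeriv i (fun g : ι → Circle => ((g i ^ m : Circle) : ℂ) - M) g =
      Complex.I * m * ((g i ^ m : Circle) : ℂ) := by
  have h : ∀ s : ℝ, (((Circle.exp s * g i) ^ m : Circle) : ℂ) - M =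
      Complex.exp ((m * Complex.I) * s) * ((g i ^ m : Circle) : ℂ) - M := by
    intro s
    rw [mul_zpow, Circle.coe_mul, ← Circle.exp_zsmul, Circle.coe_exp, zsmul_eq_mul]
    push_cast
    ring_nf
  have hd : HasDerivAt (fun s : ℝ => Complex.exp ((m * Complex.I) * s) * ((g i ^ m : Circle) : ℂ)
      - M) (Complex.exp ((m * Complex.I) * (0 : ℝ)) * ((m * Complex.I) * 1) *
        ((g i ^ m : Circle) : ℂ)) 0 :=
    ((((Complex.ofRealCLM.hasDerivAt (x := (0 : ℝ))).const_mul
      ((m : ℂ) * Complex.I)).cexp).mul_const _).sub_const M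
  simp only [angleDeriv, Function.update_self, h]
  rw [hd.deriv]
  simp [mul_comm]

/-- The nontrivial Fourier coefficients of the holonomy along an edge vanish if the edge has
infinitely many disjoint congruent copies crossing an admissible surface exactly once. -/
theorem integral_zpow_eq_zero_of_copies {κ : ℝ} (hκ : 0 < κ) {μ : Measure GenConn}
    [IsProbabilityMeasure μ] (hE : IsEuclideanInvariant μ) (hfac : IsFactorizing μ) {S : Surface}
    (hS : IsAdmissible κ μ S) (e : Edge) (T : ℕ → E3 ≃ᵃⁱ[ℝ] E3)
    (hT : ∀ k, LinearMap.det ((T k).linearIsometryEquiv.toLinearEquiv : E3 →ₗ[ℝ] E3) = 1)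
    (hcross : ∀ k, (S.crossings (e.map (T k))).Finite ∧ S.intersectionNumber (e.map (T k)) = 1)
    (hdisj : ∀ j k, j ≠ k → Disjoint (e.map (T j)).image (e.map (T k)).image) {m : ℤ}
    (hm : m ≠ 0) : ∫ A : GenConn, ((A.1 e ^ m : Circle) : ℂ) ∂μ = 0 := by
  obtain ⟨F, hF, hadm⟩ := hS
  set M := ∫ A : GenConn, ((A.1 e ^ m : Circle) : ℂ) ∂μ with hM
  have hcont := continuous_coe_zpow m
  have hmean : ∀ k, ∫ A : GenConn, ((A.1 (e.map (T k)) ^ m : Circle) : ℂ) ∂μ = M :=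
    fun k => hE.integral_map_eq (hT k) e hcont
  have hmeas : ∀ e' : Edge, Measurable fun A : GenConn => ((A.1 e' ^ m : Circle) : ℂ) :=
    fun e' => hcont.measurable.comp (measurable_holonomy e')
  have hint : ∀ e' : Edge, Integrable (fun A : GenConn => ((A.1 e' ^ m : Circle) : ℂ)) μ :=
    fun e' => Integrable.of_bound (hmeas e').aestronglyMeasurable 1
      (Filter.Eventually.of_forall fun A => (Circle.norm_coe _).le)
  have hcentered : ∀ k, ∫ A : GenConn, (((A.1 (e.map (T k)) ^ m : Circle) : ℂ) - M) ∂μ = 0 := by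
    intro k
    rw [integral_sub (hint _) (integrable_const _), hmean, integral_const]
    simp
  -- This is `Δ_S` of each centred mode, the same for every `k`.
  have hzero : conj (Complex.I * ((κ / 2 : ℝ) * (Complex.I * m * M))) = 0 := by
    refine eq_zero_of_integral_conj_mul_eq (μ := μ) (F := F) (C := 1 + ‖M‖)
      (X := fun k (A : GenConn) => ((A.1 (e.map (T k)) ^ m : Circle) : ℂ) - M)
      (fun k => (hmeas _).sub measurable_const) (fun k A => ?_) hF (fun j k hjk => ?_) fun k => ?_
    · refine (norm_sub_le _ _).trans ?_
      rw [Circle.norm_coe]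
    · have hd := hdisj j k hjk
      -- Equal copies would have an image disjoint from itself, hence empty.
      have hne : e.map (T j) ≠ e.map (T k) := by
        intro h
        rw [h, disjoint_self] at hd
        have hmem : (e.map (T k)).toFun 0 ∈ (e.map (T k)).image :=
          ⟨0, ⟨le_rfl, zero_le_one⟩, rfl⟩
        rw [hd] at hmem
        exact hmem
      have h := hfac.integral_mul hne (by rw [hd.inter_eq]; exact Set.empty_subset _)
        (c := fun z => conj (((z ^ m : Circle) : ℂ) - M)) (c' := fun z => ((z ^ m : Circle) : ℂ) - M)
        (by exact (Complex.continuous_conj.comp (hcont.sub continuous_const)).measurable)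
        (hcont.sub continuous_const).measurable
      rw [h, hcentered, mul_zero]
    · have h := hadm (Graph.single (e.map (T k)))
        (fun e' he' => by rw [Finset.mem_singleton.mp he']; exact (hcross k).1)
        (fun g => ((g default ^ m : Circle) : ℂ) - M) (smoothOnTorus_zpow_sub _ m M)
      have hflux : ∀ A : GenConn, fluxDeriv κ S (Graph.single (e.map (T k)))
          (fun g => ((g default ^ m : Circle) : ℂ) - M) (proj _ A) =
            (κ / 2 : ℝ) * (Complex.I * m * ((A.1 (e.map (T k)) ^ m : Circle) : ℂ)) := by
        intro A
        rw [fluxDeriv, Fintype.sum_unique, angleDeriv_zpow_sub, coe_single, (hcross k).2,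
          Complex.ofReal_one, one_mul]
        rfl
      simp only [hflux] at h
      rw [integral_conj, integral_const_mul, integral_const_mul, integral_const_mul, hmean] at h
      exact h.symm
  have hκ' : (κ : ℂ) ≠ 0 := by exact_mod_cast hκ.ne'
  have hm' : (m : ℂ) ≠ 0 := by exact_mod_cast hm
  simpa [hκ', hm'] using hzero

/-- Crossings are controlled only for short pieces. A vanishing coefficient on the initial piece
suffices, because the two pieces are independent and the coefficient of `e` is the product of
theirs. -/
theorem integral_zpow_holonomy_eq_zero {κ : ℝ} (hκ : 0 < κ) {μ : Measure GenConn}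
    [IsProbabilityMeasure μ] (hE : IsEuclideanInvariant μ) (hfac : IsFactorizing μ) {S : Surface}
    (hS : IsAdmissible κ μ S) (e : Edge) {m : ℤ} (hm : m ≠ 0) :
    ∫ A : GenConn, ((A.1 e ^ m : Circle) : ℂ) ∂μ = 0 := by
  obtain ⟨r, hr0, hr1, T, hT, hcross, hdisj⟩ := exists_disjoint_crossing_copies S e
  have h0 := integral_zpow_eq_zero_of_copies hκ hE hfac hS _ T hT hcross hdisj hm
  have hcomp : ∀ A : GenConn, ((A.1 e ^ m : Circle) : ℂ) =
      ((A.1 (e.piece 0 r le_rfl hr0 hr1.le) ^ m : Circle) : ℂ) *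
        ((A.1 (e.piece r 1 hr0.le hr1 le_rfl) ^ m : Circle) : ℂ) := by
    intro A
    rw [A.2.comp _ _ _ (e.isComposition_piece hr0 hr1), mul_zpow, Circle.coe_mul]
  simp only [hcomp]
  have hcont := (continuous_coe_zpow m).measurable
  rw [hfac.integral_mul (e.piece_ne_piece hr0 hr1) (e.image_piece_inter_image_piece hr0 hr1)
    hcont hcont, h0, zero_mul]

end U1Connections

end

open U1Connections in
theorem mainTheorem2 (κ : ℝ) (hκ : 0 < κ) (μ : MeasureTheory.Measure GenConn)
    [MeasureTheory.IsProbabilityMeasure μ] (hE : IsEuclideanInvariant μ) (hfac : IsFactorizing μ)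
    (hS : ∃ S : Surface, IsAdmissible κ μ S) : IsAshtekarLewandowski μ := by
  obtain ⟨S, hS⟩ := hS
  exact hfac.isAshtekarLewandowski fun e m hm =>
    integral_zpow_holonomy_eq_zero hκ hE hfac hS e hm
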